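/- Let $P$ be a finite nonempty graded poset of rank $r$: there is a function $\rho\colon P\to\mathbb N$ with $\rho(p)=1$ for every minimal element $p$ and $\rho(q)=\rho(p)+1$ whenever $q$ covers $p$, and $r=\max_{p\in P}\rho(p)$. Let $\Bbbk$ be a field, let $\mathcal F(P)\subseteq \Bbbk[x_p : p\in P]$ be the ideal generated by the monomials $\prod_{p\in I}x_p$, where $I$ runs over the maximal chains of $P$, and let $\Delta$ be the simplicial complex on $P$ whose Stanley–Reisner ideal is $\mathcal F(P)$, that is, $F\subseteq P$ is a face of $\Delta$ if and only if $\prod_{p\in F}x_p\notin\mathcal F(P)$. Let $A\subseteq P$. For $i\ge 1$ let $A_i$ be the set of elements of rank $i$ in $A$, and let $B_i$ be the set of those elements of $A_i$ that are not maximal elements of $P$. For $1\le i\le r-1$ let $G_i(A)$ be the bipartite graph on the vertex set $B_i\cup A_{i+1}$ in which $a\in B_i$ and $b\in A_{i+1}$ are joined if and only if $b$ covers $a$ in $P$, and let $X_i(A)$ be the simplicial complex on $B_i\cup A_{i+1}$ whose Stanley–Reisner ideal is the edge ideal of $G_i(A)$, i.e. whose faces are the independent sets of $G_i(A)$. Then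 the restriction $\Delta_A=\{F\in\Delta : F\subseteq A\}$ is homotopy equivalent to the join $$X_1(A) * X_2(A) * \cdots * X_{r-1}(A),$$ where the join is formed on the disjoint union of the vertex sets and the empty join (for $r=1$) is the complex $\{\emptyset\}$. -/

import Mathlib

/-! ### Simplicial complexes and Stanley–Reisner theory -/

/-- A simplicial complex on the vertex set `V`: a family of finite subsets of `V` (the faces) that
is closed under taking subsets. As usual in Stanley–Reisner theory, the empty set counts as a face,
the irrelevant complex `{∅}` is allowed, and the elements of `V` need not all be faces. -/
abbrev SComplex (V : Type*) := LowerSet (Finset V)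

/-- The squarefree monomial `x_F = ∏_{v ∈ F} x_v`. -/
noncomputable def sqfreeMonomial (k : Type*) [Field k] {V : Type*} (F : Finset V) :
    MvPolynomial V k :=
  ∏ v ∈ F, MvPolynomial.X v

/-- The Stanley–Reisner ideal of `Δ`, generated by the monomials `x_F` of the nonfaces `F`. -/
noncomputable def stanleyReisnerIdeal (k : Type*) [Field k] {V : Type*} (Δ : SComplex V) :
    Ideal (MvPolynomial V k) :=
  Ideal.span {f | ∃ F : Finset V, F ∉ Δ ∧ f = sqfreeMonomial k F}

/-- The Stanley–Reisner complex of an ideal `I`: its faces are the sets `F` with `x_F ∉ I`.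
For a squarefree monomial ideal `I` it is the unique complex whose Stanley–Reisner ideal is `I`
(`stanleyReisnerIdeal_eq_iff`). -/
def stanleyReisnerComplex {k : Type*} [Field k] {V : Type*} (I : Ideal (MvPolynomial V k)) :
    SComplex V where
  carrier := {F | sqfreeMonomial k F ∉ I}
  lower' := fun _ _ hGF hF hG =>
    hF (I.mem_of_dvd (Finset.prod_dvd_prod_of_subset _ _ _ hGF) hG)

/-- The restriction `Δ_A` of `Δ` to a set `A` of vertices: the faces contained in `A`. -/
def SComplex.restrict {V : Type*} (Δ : SComplex V) (A : Set V) : SComplex V where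
  carrier := {F | F ∈ Δ ∧ (F : Set V) ⊆ A}
  lower' := fun _ _ hGF hF =>
    ⟨Δ.lower hGF hF.1, (Finset.coe_subset.mpr hGF).trans hF.2⟩

/-- The join of a family of complexes, on the disjoint union of their vertex sets: a face is a
disjoint union of one face of each member. The join of the empty family is `{∅}`. -/
def SComplex.join {ι : Type*} {V : ι → Type*} (X : ∀ i, SComplex (V i)) :
    SComplex (Σ i, V i) where
  carrier := {F | ∀ i, F.preimage (Sigma.mk i) sigma_mk_injective.injOn ∈ X i}
  lower' := fun _ _ hGF hF i => (X i).lower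
    (fun _ hv => Finset.mem_preimage.mpr (hGF (Finset.mem_preimage.mp hv))) (hF i)

/-- The geometric realization of a complex on a finite vertex set, with the subspace topology
of `ℝ^V`: the union over the faces `F` of the simplices with vertices `e_v`, `v ∈ F`, written in
barycentric coordinates. It is empty for `{∅}`. -/
def SComplex.realization {V : Type*} [Finite V] (Δ : SComplex V) : Set (V → ℝ) :=
  {x | ∃ F ∈ Δ, (∀ v, v ∉ F → x v = 0) ∧ (∀ v, 0 ≤ x v) ∧ ∑ v ∈ F, x v = 1}

/-- Two finite complexes are homotopy equivalent if their geometric realizations are. -/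
def SComplex.HomotopyEquivalent {V W : Type*} [Finite V] [Finite W]
    (Δ : SComplex V) (Γ : SComplex W) : Prop :=
  Nonempty (ContinuousMap.HomotopyEquiv Δ.realization Γ.realization)

theorem sqfreeMonomial_eq_monomial (k : Type*) [Field k] {V : Type*} (F : Finset V) :
    sqfreeMonomial k F = MvPolynomial.monomial (∑ v ∈ F, Finsupp.single v 1) (1 : k) := by
  rw [sqfreeMonomial, MvPolynomial.monomial_sum_one]
  rfl

theorem sqfreeMonomial_mem_span_iff (k : Type*) [Field k] {V : Type*} (S : Set (Finset V))
    (F : Finset V) :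
    sqfreeMonomial k F ∈ Ideal.span (sqfreeMonomial k '' S) ↔ ∃ G ∈ S, G ⊆ F := by
  classical
  constructor
  · intro h
    have hS : sqfreeMonomial k '' S = (fun s => MvPolynomial.monomial s (1 : k)) ''
        ((fun G : Finset V => ∑ v ∈ G, Finsupp.single v 1) '' S) := by
      rw [Set.image_image]
      exact Set.image_congr fun G _ => sqfreeMonomial_eq_monomial k G
    rw [hS, MvPolynomial.mem_ideal_span_monomial_image, sqfreeMonomial_eq_monomial] at h
    obtain ⟨_, ⟨G, hG, rfl⟩, hle⟩ := h (∑ v ∈ F, Finsupp.single v 1)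
      (by simp [MvPolynomial.mem_support_iff])
    refine ⟨G, hG, fun v hv => ?_⟩
    have := hle v
    by_contra hvF
    simp [Finsupp.finsetSum_apply, Finsupp.single_apply, hv, hvF] at this
  · rintro ⟨G, hG, hGF⟩
    exact Ideal.mem_of_dvd _ (Finset.prod_dvd_prod_of_subset _ _ _ hGF)
      (Ideal.subset_span ⟨G, hG, rfl⟩)

/-- For an ideal `I` generated by squarefree monomials, `stanleyReisnerComplex I` is the one and
only complex whose Stanley–Reisner ideal is `I`. -/
theorem stanleyReisnerIdeal_eq_iff {k : Type*} [Field k] {V : Type*} (S : Set (Finset V))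
    (Δ : SComplex V) :
    stanleyReisnerIdeal k Δ = Ideal.span (sqfreeMonomial k '' S) ↔
      Δ = stanleyReisnerComplex (Ideal.span (sqfreeMonomial k '' S)) := by
  have hset : ∀ Γ : SComplex V, stanleyReisnerIdeal k Γ =
      Ideal.span (sqfreeMonomial k '' {F | F ∉ Γ}) := fun Γ => by
    unfold stanleyReisnerIdeal
    congr 1
    ext f
    exact ⟨fun ⟨F, h, e⟩ => ⟨F, h, e.symm⟩, fun ⟨F, h, e⟩ => ⟨F, h, e.symm⟩⟩
  constructor
  · intro h
    rw [← h, hset]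
    ext F
    change F ∈ Δ ↔ sqfreeMonomial k F ∉ _
    rw [sqfreeMonomial_mem_span_iff]
    exact ⟨fun hF ⟨G, hG, hGF⟩ => hG (Δ.lower hGF hF),
      fun h => by_contra fun hF => h ⟨F, hF, subset_rfl⟩⟩
  · rintro rfl
    rw [hset]
    apply le_antisymm
    · rw [Ideal.span_le]
      rintro _ ⟨F, hF, rfl⟩
      exact not_not.mp hF
    · rw [Ideal.span_le]
      rintro _ ⟨F, hF, rfl⟩
      exact Ideal.subset_span ⟨F, not_not.mpr (Ideal.subset_span ⟨F, hF, rfl⟩), rfl⟩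

/-! ### Graded posets, flag ideals and the bipartite graphs of a multidegree -/

/-- `ρ` is a rank function on the poset `P`: minimal elements have rank `1`, and the rank goes up
by `1` along every cover relation. A poset is graded if it has a rank function. -/
structure IsRankFunction {P : Type*} [PartialOrder P] (ρ : P → ℕ) : Prop where
  minimal : ∀ p, IsMin p → ρ p = 1
  covBy : ∀ p q, p ⋖ q → ρ q = ρ p + 1

/-- The flag ideal `F(P)`, generated by the monomials `x_I` of the maximal chains `I` of `P`. -/
noncomputable def flagIdeal (k : Type*) [Field k] (P : Type*) [PartialOrder P] :
    Ideal (MvPolynomial P k) :=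
  Ideal.span (sqfreeMonomial k '' {I : Finset P | IsMaxChain (· ≤ ·) (I : Set P)})

/-- The edge ideal of a graph, generated by the monomials `x_a x_b` of its edges `{a, b}`. -/
noncomputable def edgeIdeal (k : Type*) [Field k] {V : Type*} (G : SimpleGraph V) :
    Ideal (MvPolynomial V k) :=
  Ideal.span {f | ∃ a b, G.Adj a b ∧ f = MvPolynomial.X a * MvPolynomial.X b}

/-- The edge ideal is a squarefree monomial ideal. -/
theorem edgeIdeal_eq_span (k : Type*) [Field k] {V : Type*} [DecidableEq V] (G : SimpleGraph V) :
    edgeIdeal k G =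
      Ideal.span (sqfreeMonomial k '' {F : Finset V | ∃ a b, G.Adj a b ∧ F = {a, b}}) := by
  unfold edgeIdeal
  congr 1
  ext f
  constructor
  · rintro ⟨a, b, h, rfl⟩
    exact ⟨{a, b}, ⟨a, b, h, rfl⟩, Finset.prod_pair h.ne⟩
  · rintro ⟨_, ⟨a, b, h, rfl⟩, rfl⟩
    exact ⟨a, b, h, Finset.prod_pair h.ne⟩

section Multidegree

variable {P : Type*} [PartialOrder P]

/-- `A_i`, the set of elements of rank `i` in `A`. -/
def rankPart (ρ : P → ℕ) (A : Set P) (i : ℕ) : Set P := {p | p ∈ A ∧ ρ p = i}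

/-- `B_i = A_i \ max(P)`, the elements of rank `i` in `A` that are not maximal in `P`. -/
def nonmaxPart (ρ : P → ℕ) (A : Set P) (i : ℕ) : Set P := {p | p ∈ rankPart ρ A i ∧ ¬ IsMax p}

/-- The vertex set `B_i ∪ A_{i+1}`. -/
def bipartiteVertices (ρ : P → ℕ) (A : Set P) (i : ℕ) : Set P :=
  nonmaxPart ρ A i ∪ rankPart ρ A (i + 1)

/-- The bipartite graph `G_i(A)` on `B_i ∪ A_{i+1}`: `a` and `b` are joined if one covers the other
in `P`. As covers raise the rank by one, all its edges are between `B_i` and `A_{i+1}`. -/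
def bipartiteGraph (ρ : P → ℕ) (A : Set P) (i : ℕ) : SimpleGraph (bipartiteVertices ρ A i) :=
  (SimpleGraph.hasse P).induce (bipartiteVertices ρ A i)

/-- The complex `X_i(A)` on `B_i ∪ A_{i+1}` whose Stanley–Reisner ideal is the edge ideal of
`G_i(A)`. -/
noncomputable def bipartiteComplex (k : Type*) [Field k] (ρ : P → ℕ) (A : Set P) (i : ℕ) :
    SComplex (bipartiteVertices ρ A i) :=
  stanleyReisnerComplex (edgeIdeal k (bipartiteGraph ρ A i))

end Multidegree

/-! ### Homotopy equivalences of geometric realizations -/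

namespace SComplex

section Realization

variable {V : Type*} [Fintype V] {Δ : SComplex V}

/-! Forgetting the index is a simplicial map `π` from the join `J` to `Δ_A`. Its fibre over each
nonempty face `F`, the faces of `J` lying over `F`, is a cone, so `π` is a homotopy equivalence as
in Quillen's fibre lemma.

Combinatorial input: if `F` contains no maximal chain, climb inside `F` along covers from a minimal
element of `P` as far in rank as possible. The end `p` is not maximal in `P`, and nothing in `F`
covers it, so its copy in `B_{ρ p}` has no neighbour over `F`. If `F` contains no minimal element of
`P`, an element of least rank in `F`, placed on the upper side, is isolated instead
(`exists_isolated_vertex`). Conversely, a maximal chain in the image of a face would force an edge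
inside that face (`not_isMaxChain_of_subset_image_join`).

Topological input (`homotopyEquivalent_of_cone_fibres`): an explicit inverse sends `x` to a weighted
mean of the cone points of its superlevel sets. These sets form a chain, so their cone points span a
face. Raising a level `u` from 0 to 1, which truncates `y` and brings in the cone points, deforms
the identity of `J` to the composite. -/

theorem mem_realization_iff {x : V → ℝ} :
    x ∈ Δ.realization ↔
      (Finset.univ.filter fun v => x v ≠ 0) ∈ Δ ∧ (∀ v, 0 ≤ x v) ∧ ∑ v, x v = 1 := by
  constructor
  · rintro ⟨F, hF, h0, hpos, hsum⟩
    refine ⟨Δ.lower (fun v hv => ?_) hF, hpos, ?_⟩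
    · by_contra hvF
      exact (Finset.mem_filter.mp hv).2 (h0 v hvF)
    · rw [← hsum]
      exact (Finset.sum_subset (Finset.subset_univ F) fun v _ hv => h0 v hv).symm
  · rintro ⟨hF, hpos, hsum⟩
    refine ⟨_, hF, fun v hv => by simpa using hv, hpos, ?_⟩
    rw [← hsum]
    exact Finset.sum_filter_ne_zero Finset.univ

/-- Rescaling a vector so that its coordinates add up to `1`. -/
noncomputable def normalize (z : V → ℝ) : V → ℝ := fun v => z v / ∑ u, z u

theorem normalize_mem_realization {z : V → ℝ} (hz : ∀ v, 0 ≤ z v) (hsum : 0 < ∑ v, z v)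
    {F : Finset V} (hF : F ∈ Δ) (hsupp : ∀ v, z v ≠ 0 → v ∈ F) :
    normalize z ∈ Δ.realization := by
  refine mem_realization_iff.mpr ⟨Δ.lower (fun v hv => hsupp v fun h => ?_) hF,
    fun v => div_nonneg (hz v) hsum.le, ?_⟩
  · exact (Finset.mem_filter.mp hv).2 (by simp [normalize, h])
  · simp only [normalize]
    rw [← Finset.sum_div, div_self hsum.ne']

theorem normalize_eq_self {z : V → ℝ} (hsum : ∑ v, z v = 1) : normalize z = z := by
  funext v
  simp [normalize, hsum]

theorem continuous_normalize {X : Type*} [TopologicalSpace X] {f : X → V → ℝ} (hf : Continuous f)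
    (hsum : ∀ x, 0 < ∑ v, f x v) : Continuous fun x => normalize (f x) := by
  refine continuous_pi fun v => Continuous.div (by fun_prop) (by fun_prop) fun x => (hsum x).ne'

/-- Two maps into a realization whose values at each point lie in a common simplex are
homotopic. -/
theorem homotopic_of_common_face {X : Type*} [TopologicalSpace X] (f g : C(X, Δ.realization))
    (h : ∀ x, ∃ F ∈ Δ, ∀ v, ((f x : V → ℝ) v ≠ 0 → v ∈ F) ∧ ((g x : V → ℝ) v ≠ 0 → v ∈ F)) :
    f.Homotopic g := by
  have hmem : ∀ p : unitInterval × X,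
      ((1 - (p.1 : ℝ)) • (f p.2 : V → ℝ) + (p.1 : ℝ) • (g p.2 : V → ℝ)) ∈ Δ.realization := by
    rintro ⟨t, x⟩
    obtain ⟨F, hF, hv⟩ := h x
    obtain ⟨-, hf, hfs⟩ := mem_realization_iff.mp (f x).2
    obtain ⟨-, hg, hgs⟩ := mem_realization_iff.mp (g x).2
    refine mem_realization_iff.mpr ⟨Δ.lower (fun v hvm => ?_) hF, fun v => ?_, ?_⟩
    · by_contra hvF
      refine (Finset.mem_filter.mp hvm).2 ?_
      have h1 : (f x : V → ℝ) v = 0 := by_contra fun h => hvF ((hv v).1 h)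
      have h2 : (g x : V → ℝ) v = 0 := by_contra fun h => hvF ((hv v).2 h)
      simp [h1, h2]
    · exact add_nonneg (mul_nonneg (sub_nonneg.mpr t.2.2) (hf v)) (mul_nonneg t.2.1 (hg v))
    · simp only [Pi.add_apply, Pi.smul_apply, smul_eq_mul, Finset.sum_add_distrib,
        ← Finset.mul_sum, hfs, hgs]
      ring
  exact ⟨{
    toFun := fun p => ⟨_, hmem p⟩
    continuous_toFun := by
      refine Continuous.subtype_mk ?_ _
      have h1 : Continuous fun p : unitInterval × X => (f p.2 : V → ℝ) :=
        continuous_subtype_val.comp (f.continuous.comp continuous_snd)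
      have h2 : Continuous fun p : unitInterval × X => (g p.2 : V → ℝ) :=
        continuous_subtype_val.comp (g.continuous.comp continuous_snd)
      have h3 : Continuous fun p : unitInterval × X => (p.1 : ℝ) :=
        continuous_subtype_val.comp continuous_fst
      exact ((continuous_const.sub h3).smul h1).add (h3.smul h2)
    map_zero_left := fun x => Subtype.ext (by simp)
    map_one_left := fun x => Subtype.ext (by simp) }⟩

end Realization

/-! ### Continuous weights on superlevel sets -/

section Weight

variable {V : Type*} [Fintype V] [DecidableEq V]

/-- A continuous weight on the sets `F` of vertices that vanishes unless `F` is a superlevel set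
of `x` at some level in `[0, u)`, and is positive if `F` is the support of `x` and `u > 0`. -/
noncomputable def superlevelWeight (u : ℝ) (x : V → ℝ) (F : Finset V) : ℝ :=
  u * (∏ b ∈ Fᶜ, max 0 (u - x b)) * ∏ a ∈ F, (max 0 (x a) * ∏ b ∈ Fᶜ, max 0 (x a - x b))

theorem superlevelWeight_nonneg {u : ℝ} (hu : 0 ≤ u) (x : V → ℝ) (F : Finset V) :
    0 ≤ superlevelWeight u x F := by
  unfold superlevelWeight
  refine mul_nonneg (mul_nonneg hu (Finset.prod_nonneg fun _ _ => le_max_left _ _))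
    (Finset.prod_nonneg fun _ _ => mul_nonneg (le_max_left _ _)
      (Finset.prod_nonneg fun _ _ => le_max_left _ _))

theorem superlevelWeight_zero (x : V → ℝ) (F : Finset V) : superlevelWeight 0 x F = 0 := by
  simp [superlevelWeight]

theorem continuous_superlevelWeight {X : Type*} [TopologicalSpace X] {u : X → ℝ} {x : X → V → ℝ}
    (hu : Continuous u) (hx : Continuous x) (F : Finset V) :
    Continuous fun t => superlevelWeight (u t) (x t) F := by
  unfold superlevelWeight
  fun_prop

/-- Each factor of the weight is a truncated difference, so a nonzero product makes all these
inequalities strict. -/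
theorem superlevelWeight_ne_zero {u : ℝ} {x : V → ℝ} {F : Finset V}
    (h : superlevelWeight u x F ≠ 0) :
    (∀ b ∉ F, x b < u) ∧ (∀ a ∈ F, 0 < x a) ∧ ∀ a ∈ F, ∀ b ∉ F, x b < x a := by
  have hmax : ∀ s : ℝ, max 0 s ≠ 0 → 0 < s := fun s hs => by
    by_contra hn
    exact hs (max_eq_left (not_lt.mp hn))
  simp only [superlevelWeight, ne_eq, mul_eq_zero, not_or, Finset.prod_eq_zero_iff,
    not_exists, not_and, Finset.mem_compl] at h
  exact ⟨fun b hb => sub_pos.mp (hmax _ (h.1.2 b hb)), fun a ha => hmax _ (h.2 a ha).1,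
    fun a ha b hb => sub_pos.mp (hmax _ ((h.2 a ha).2 b hb))⟩

theorem superlevelWeight_support_pos {u : ℝ} (hu : 0 < u) {x : V → ℝ} (hx : ∀ v, 0 ≤ x v) :
    0 < superlevelWeight u x (Finset.univ.filter fun v => x v ≠ 0) := by
  have hc : ∀ b ∈ (Finset.univ.filter fun v => x v ≠ 0)ᶜ, x b = 0 := fun b hb => by
    simpa using hb
  have hp : ∀ a ∈ (Finset.univ.filter fun v => x v ≠ 0), 0 < x a := fun a ha =>
    lt_of_le_of_ne (hx a) (Ne.symm (Finset.mem_filter.mp ha).2)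
  refine mul_pos (mul_pos hu (Finset.prod_pos fun b hb => ?_)) (Finset.prod_pos fun a ha =>
    mul_pos (lt_max_of_lt_right (hp a ha)) (Finset.prod_pos fun b hb => ?_))
  · exact lt_max_of_lt_right (by rwa [hc b hb, sub_zero])
  · exact lt_max_of_lt_right (by rw [hc b hb, sub_zero]; exact hp a ha)

/-- Sets of nonzero weight form a chain. -/
theorem subset_of_superlevelWeight_ne_zero {u : ℝ} {x : V → ℝ} {F F' : Finset V}
    (h : superlevelWeight u x F ≠ 0) (h' : superlevelWeight u x F' ≠ 0)
    (hcard : F.card ≤ F'.card) : F ⊆ F' := by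
  by_contra hsub
  obtain ⟨a, haF, haF'⟩ := Finset.not_subset.mp hsub
  -- Points `a ∈ F \ F'` and `b ∈ F' \ F` would give both `x b < x a` and `x a < x b`.
  have hsub' : F' ⊆ F := fun b hb => by
    by_contra hbF
    exact lt_asymm ((superlevelWeight_ne_zero h).2.2 a haF b hbF)
      ((superlevelWeight_ne_zero h').2.2 b hb a haF')
  exact hsub (Finset.eq_of_subset_of_card_le hsub' hcard).ge

end Weight

/-! ### Simplicial maps with conical fibres -/

section ConeFibres

variable {V W : Type*} {Δ : SComplex V} {J : SComplex W}

/-- Adding the cone points of a chain of faces to a face below the chain gives a face. -/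
theorem union_image_apex_mem [DecidableEq W] {π : W → V}
    {c : {F : Finset V // F ∈ Δ ∧ F.Nonempty} → W}
    (hcF : ∀ F, π (c F) ∈ F.1)
    (hcone : ∀ F, ∀ G ∈ J, (∀ w ∈ G, π w ∈ F.1) → insert (c F) G ∈ J)
    {G : Finset W} (hG : G ∈ J) (S : Finset {F : Finset V // F ∈ Δ ∧ F.Nonempty})
    (hchain : ∀ F ∈ S, ∀ F' ∈ S, F.1.card ≤ F'.1.card → F.1 ⊆ F'.1)
    (hGS : ∀ F ∈ S, ∀ w ∈ G, π w ∈ F.1) :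
    G ∪ S.image c ∈ J := by
  classical
  -- Adding the largest set last ensures that all earlier cone points lie over it, so that `hcone`
  -- applies.
  induction S using Finset.induction_on_max_value
    (fun F : {F : Finset V // F ∈ Δ ∧ F.Nonempty} => F.1.card) with
  | empty => simpa using hG
  | insert F S hFS hmax ih =>
    have hS := ih (fun A hA B hB => hchain A (Finset.mem_insert_of_mem hA) B
      (Finset.mem_insert_of_mem hB)) fun A hA => hGS A (Finset.mem_insert_of_mem hA)
    rw [Finset.image_insert, Finset.union_insert]
    refine hcone F _ hS fun w hw => ?_
    rcases Finset.mem_union.mp hw with hw | hw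
    · exact hGS F (Finset.mem_insert_self _ _) w hw
    · obtain ⟨F', hF', rfl⟩ := Finset.mem_image.mp hw
      exact hchain F' (Finset.mem_insert_of_mem hF') F (Finset.mem_insert_self _ _)
        (hmax F' hF') (hcF F')

/-- The linear map `ℝ^W → ℝ^V` induced by a map of vertices. -/
def pushforward [Fintype W] [DecidableEq V] (π : W → V) (y : W → ℝ) : V → ℝ :=
  fun v => ∑ w, if π w = v then y w else 0

theorem continuous_pushforward [Fintype W] [DecidableEq V] (π : W → V) :
    Continuous (pushforward π) := by
  unfold pushforward
  refine continuous_pi fun v => continuous_finsetSum _ fun w _ => ?_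
  split_ifs <;> fun_prop

theorem le_pushforward [Fintype W] [DecidableEq V] (π : W → V) {y : W → ℝ} (hy : ∀ w, 0 ≤ y w)
    (w : W) : y w ≤ pushforward π y (π w) := by
  have h := Finset.single_le_sum (s := Finset.univ)
    (f := fun w' => if π w' = π w then y w' else 0)
    (fun w' _ => by split_ifs <;> simp [hy]) (Finset.mem_univ w)
  simpa [pushforward] using h

theorem pushforward_ne_zero [Fintype W] [DecidableEq V] {π : W → V} {y : W → ℝ} {v : V}
    (h : pushforward π y v ≠ 0) : ∃ w, π w = v ∧ y w ≠ 0 := by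
  obtain ⟨w, -, hw⟩ := Finset.exists_ne_zero_of_sum_ne_zero h
  by_cases hv : π w = v
  · exact ⟨w, hv, by simpa [hv] using hw⟩
  · simp [hv] at hw

theorem pushforward_mem_realization [Fintype V] [Fintype W] [DecidableEq V] {π : W → V}
    (hπ : ∀ G ∈ J, G.image π ∈ Δ) {y : W → ℝ} (hy : y ∈ J.realization) :
    pushforward π y ∈ Δ.realization := by
  obtain ⟨hG, hpos, hsum⟩ := mem_realization_iff.mp hy
  refine mem_realization_iff.mpr ⟨Δ.lower (fun v hv => ?_) (hπ _ hG), fun v => ?_, ?_⟩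
  · obtain ⟨w, rfl, hw⟩ := pushforward_ne_zero (Finset.mem_filter.mp hv).2
    exact Finset.mem_image_of_mem π (by simpa using hw)
  · exact Finset.sum_nonneg fun w _ => by split_ifs <;> simp [hpos]
  · rw [← hsum]
    unfold pushforward
    rw [Finset.sum_comm]
    simp

section Apex

variable [Fintype V] [DecidableEq V] [DecidableEq W]

/-- The unnormalized combination of the cone points of the superlevel sets of `x` at levels below
`u` with the part of `y` above the level `u`. -/
noncomputable def apexSum (c : {F : Finset V // F ∈ Δ ∧ F.Nonempty} → W)
    [Fintype {F : Finset V // F ∈ Δ ∧ F.Nonempty}] (u : ℝ) (x : V → ℝ) (y : W → ℝ) : W → ℝ :=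
  fun w => max 0 (y w - u) + ∑ F, if c F = w then superlevelWeight u x F.1 else 0

variable {c : {F : Finset V // F ∈ Δ ∧ F.Nonempty} → W}
  [Fintype {F : Finset V // F ∈ Δ ∧ F.Nonempty}]

theorem continuous_apexSum {X : Type*} [TopologicalSpace X] {u : X → ℝ} {x : X → V → ℝ}
    {y : X → W → ℝ} (hu : Continuous u) (hx : Continuous x) (hy : Continuous y) :
    Continuous fun t => apexSum c (u t) (x t) (y t) := by
  unfold apexSum
  refine continuous_pi fun w => Continuous.add (by fun_prop) (continuous_finsetSum _ fun F _ => ?_)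
  split_ifs
  · exact continuous_superlevelWeight hu hx F.1
  · exact continuous_const

theorem apexSum_nonneg {u : ℝ} (hu : 0 ≤ u) (x : V → ℝ) (y : W → ℝ) (w : W) :
    0 ≤ apexSum c u x y w := by
  refine add_nonneg (le_max_left _ _) (Finset.sum_nonneg fun F _ => ?_)
  split_ifs
  · exact superlevelWeight_nonneg hu x F.1
  · exact le_rfl

theorem apexSum_ne_zero {u : ℝ} {x : V → ℝ} {y : W → ℝ} {w : W} (h : apexSum c u x y w ≠ 0) :
    u < y w ∨ ∃ F, c F = w ∧ superlevelWeight u x F.1 ≠ 0 := by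
  by_contra hn
  push Not at hn
  refine h ?_
  have h1 : max 0 (y w - u) = 0 := max_eq_left (sub_nonpos.mpr hn.1)
  rw [apexSum, h1, zero_add]
  refine Finset.sum_eq_zero fun F _ => ?_
  split_ifs with hF
  · exact hn.2 F hF
  · rfl

theorem apexSum_zero {x : V → ℝ} {y : W → ℝ} (hy : ∀ w, 0 ≤ y w) : apexSum c 0 x y = y := by
  funext w
  simp [apexSum, superlevelWeight_zero, hy]

theorem apexSum_one {x : V → ℝ} {y : W → ℝ} (hy : ∀ w, y w ≤ 1) :
    apexSum c 1 x y = apexSum c 1 x 0 := by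
  funext w
  simp [apexSum, hy]

/-- The support of `x` is a nonempty face of positive weight, so its cone point contributes. -/
theorem sum_apexSum_pos [Fintype W] {u : ℝ} (hu : 0 < u) {x : V → ℝ} (hx : x ∈ Δ.realization)
    (y : W → ℝ) : 0 < ∑ w, apexSum c u x y w := by
  obtain ⟨hF, hpos, hsum⟩ := mem_realization_iff.mp hx
  have hne : (Finset.univ.filter fun v => x v ≠ 0).Nonempty := by
    obtain ⟨v, -, hv⟩ := Finset.exists_ne_zero_of_sum_ne_zero (hsum.trans_ne one_ne_zero)
    exact ⟨v, by simpa using hv⟩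
  refine Finset.sum_pos' (fun w _ => apexSum_nonneg hu.le x y w)
    ⟨c ⟨_, hF, hne⟩, Finset.mem_univ _, ?_⟩
  refine add_pos_of_nonneg_of_pos (le_max_left _ _)
    (Finset.sum_pos' (fun F _ => ?_) ⟨⟨_, hF, hne⟩, Finset.mem_univ _, ?_⟩)
  · split_ifs
    · exact superlevelWeight_nonneg hu.le x F.1
    · exact le_rfl
  · rw [if_pos rfl]
    exact superlevelWeight_support_pos hu hpos

/-- A set `F` of nonzero weight contains every vertex where `x ≥ u`. If `u < y w`, then `u < x (π
w)` by `hyx`, so the surviving part of `y` lies over the whole chain of such sets. -/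
theorem normalize_apexSum_mem [Fintype W] {π : W → V} (hcF : ∀ F, π (c F) ∈ F.1)
    (hcone : ∀ F, ∀ G ∈ J, (∀ w ∈ G, π w ∈ F.1) → insert (c F) G ∈ J)
    {u : ℝ} (hu : 0 ≤ u) {x : V → ℝ} {y : W → ℝ}
    (hy : (Finset.univ.filter fun w => u < y w) ∈ J) (hyx : ∀ w, y w ≤ x (π w))
    (hsum : 0 < ∑ w, apexSum c u x y w) : normalize (apexSum c u x y) ∈ J.realization := by
  refine normalize_mem_realization (apexSum_nonneg hu x y) hsum
    (union_image_apex_mem hcF hcone hy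
      (Finset.univ.filter fun F => superlevelWeight u x F.1 ≠ 0) ?_ ?_) fun w hw => ?_
  · intro F hF F' hF'
    exact subset_of_superlevelWeight_ne_zero (Finset.mem_filter.mp hF).2
      (Finset.mem_filter.mp hF').2
  · intro F hF w hw
    by_contra hn
    have h1 := (superlevelWeight_ne_zero (Finset.mem_filter.mp hF).2).1 _ hn
    exact lt_irrefl _ (((Finset.mem_filter.mp hw).2.trans_le (hyx w)).trans h1)
  · rcases apexSum_ne_zero hw with h | ⟨F, rfl, hF⟩
    · exact Finset.mem_union_left _ (by simpa using h)
    · exact Finset.mem_union_right _ (Finset.mem_image_of_mem c (by simpa using hF))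

end Apex

/-- A simplicial map whose fibre over every nonempty face is a cone is a homotopy equivalence: if
for every nonempty face `F` of `Δ` there is a vertex `w` over `F` that can be added to every face
of `J` lying over `F`, then `Δ` and `J` are homotopy equivalent. -/
theorem homotopyEquivalent_of_cone_fibres [Finite V] [Finite W] [DecidableEq V] [DecidableEq W]
    (π : W → V) (hJ : ∅ ∈ J) (hπ : ∀ G ∈ J, G.image π ∈ Δ)
    (hcone : ∀ F ∈ Δ, F.Nonempty → ∃ w, π w ∈ F ∧
      ∀ G ∈ J, (∀ w ∈ G, π w ∈ F) → insert w G ∈ J) :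
    HomotopyEquivalent Δ J := by
  classical
  have := Fintype.ofFinite V
  have := Fintype.ofFinite W
  choose c hcF hc using fun F : {F : Finset V // F ∈ Δ ∧ F.Nonempty} => hcone F.1 F.2.1 F.2.2
  have hsmem : ∀ x ∈ Δ.realization, normalize (apexSum c 1 x 0) ∈ J.realization := fun x hx => by
    refine normalize_apexSum_mem hcF hc zero_le_one ?_ (fun w => (mem_realization_iff.mp hx).2.1 _)
      (sum_apexSum_pos one_pos hx 0)
    have h0 : (Finset.univ.filter fun w : W => (1 : ℝ) < (0 : W → ℝ) w) = ∅ := by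
      simp [zero_le_one]
    rwa [h0]
  let s : C(Δ.realization, J.realization) :=
    ⟨fun x => ⟨_, hsmem x.1 x.2⟩, Continuous.subtype_mk (continuous_normalize
      (continuous_apexSum continuous_const continuous_subtype_val continuous_const)
      fun x => sum_apexSum_pos one_pos x.2 0) _⟩
  let p : C(J.realization, Δ.realization) :=
    ⟨fun y => ⟨_, pushforward_mem_realization hπ y.2⟩,
      Continuous.subtype_mk ((continuous_pushforward π).comp continuous_subtype_val) _⟩
  refine ⟨⟨s, p, ?_, ?_⟩⟩
  -- Sets of nonzero weight lie in the support of `x`, and each cone point lies over its set; hence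
  -- `p (s x)` is supported in the support of `x`.
  · refine homotopic_of_common_face _ _ fun x =>
      ⟨_, (mem_realization_iff.mp x.2).1, fun v => ⟨fun hv => ?_, fun hv => by simpa using hv⟩⟩
    obtain ⟨w, rfl, hw⟩ := pushforward_ne_zero (show pushforward π
      (normalize (apexSum c 1 (x : V → ℝ) 0)) v ≠ 0 from hv)
    have hw' : apexSum c 1 (x : V → ℝ) 0 w ≠ 0 := fun h => hw (by simp [normalize, h])
    rcases apexSum_ne_zero hw' with h | ⟨F, rfl, hF⟩
    · exact absurd h (by simp [zero_le_one])
    · simpa using ((superlevelWeight_ne_zero hF).2.1 _ (hcF F)).ne'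
  -- At `u = 0` all weights vanish, and positivity comes from `y` itself.
  · have hsum : ∀ (u : unitInterval) (y : J.realization),
        0 < ∑ w, apexSum c (u : ℝ) (pushforward π y) (y : W → ℝ) w := fun u y => by
      obtain ⟨-, hpos, hsum⟩ := mem_realization_iff.mp y.2
      rcases u.2.1.eq_or_lt with h | h
      · rw [← h, apexSum_zero hpos, hsum]
        exact one_pos
      · exact sum_apexSum_pos h (pushforward_mem_realization hπ y.2) _
    have hmem : ∀ (u : unitInterval) (y : J.realization),
        normalize (apexSum c (u : ℝ) (pushforward π y) (y : W → ℝ)) ∈ J.realization := fun u y => by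
      obtain ⟨hG, hpos, -⟩ := mem_realization_iff.mp y.2
      refine normalize_apexSum_mem hcF hc u.2.1 (J.lower (fun w hw => ?_) hG)
        (le_pushforward π hpos) (hsum u y)
      simpa using (u.2.1.trans_lt (Finset.mem_filter.mp hw).2).ne'
    refine ContinuousMap.Homotopic.symm ⟨{
      toFun := fun q => ⟨_, hmem q.1 q.2⟩
      continuous_toFun := Continuous.subtype_mk (continuous_normalize
        (continuous_apexSum (continuous_subtype_val.comp continuous_fst)
          ((continuous_pushforward π).comp (continuous_subtype_val.comp continuous_snd))
          (continuous_subtype_val.comp continuous_snd)) fun q => hsum q.1 q.2) _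
      map_zero_left := fun y => Subtype.ext ?_
      map_one_left := fun y => Subtype.ext ?_ }⟩
    · obtain ⟨-, hpos, hs⟩ := mem_realization_iff.mp y.2
      change normalize (apexSum c 0 _ _) = (y : W → ℝ)
      rw [apexSum_zero hpos, normalize_eq_self hs]
    · obtain ⟨-, hpos, hs⟩ := mem_realization_iff.mp y.2
      change normalize (apexSum c 1 _ _) = normalize (apexSum c 1 _ 0)
      rw [apexSum_one fun w => ?_]
      · rfl
      · rw [← hs]
        exact Finset.single_le_sum (fun w _ => hpos w) (Finset.mem_univ w)

end ConeFibres

end SComplex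

/-! ### Maximal chains and the bipartite complexes -/

section Chains

variable {P : Type*} [PartialOrder P]

theorem IsMaxChain.mem_of_forall_le_or_le {I : Set P} (hI : IsMaxChain (· ≤ ·) I) {z : P}
    (hz : ∀ y ∈ I, z ≤ y ∨ y ≤ z) : z ∈ I := by
  have h := hI.2 (hI.1.insert fun y hy _ => hz y hy) (Set.subset_insert z I)
  exact h ▸ Set.mem_insert z I

/-- Anything below the least element of `I` is comparable with all of `I`, hence belongs to `I` by
maximality. -/
theorem IsMaxChain.exists_isMin [Finite P] [Nonempty P] {I : Set P}
    (hI : IsMaxChain (· ≤ ·) I) : ∃ p ∈ I, IsMin p := by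
  have hne : I.Nonempty := by
    by_contra h
    rw [Set.not_nonempty_iff_eq_empty] at h
    subst h
    obtain ⟨p⟩ := ‹Nonempty P›
    exact hI.mem_of_forall_le_or_le (z := p) (by simp)
  obtain ⟨p, hp⟩ := (Set.toFinite I).exists_minimal hne
  refine ⟨p, hp.prop, fun z hz => ?_⟩
  refine hp.le_of_le (hI.mem_of_forall_le_or_le fun y hy => Or.inl (hz.trans ?_)) hz
  rcases hI.1.total hp.prop hy with h | h
  · exact h
  · exact hp.le_of_le hy h

/-- The next element of `I` after `p` works: anything strictly between could be added to the chain.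
-/
theorem IsMaxChain.exists_covBy [Finite P] {I : Set P} (hI : IsMaxChain (· ≤ ·) I) {p : P}
    (hp : p ∈ I) (hmax : ¬ IsMax p) : ∃ q ∈ I, p ⋖ q := by
  have hne : {q | q ∈ I ∧ p < q}.Nonempty := by
    by_contra h
    rw [Set.not_nonempty_iff_eq_empty, Set.eq_empty_iff_forall_notMem] at h
    obtain ⟨z, hz⟩ := not_isMax_iff.mp hmax
    refine h z ⟨hI.mem_of_forall_le_or_le fun y hy => Or.inr ?_, hz⟩
    rcases hI.1.total hp hy with h' | h'
    · rcases h'.eq_or_lt with rfl | h''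
      · exact hz.le
      · exact absurd ⟨hy, h''⟩ (h y)
    · exact h'.trans hz.le
  obtain ⟨q, hq⟩ := (Set.toFinite _).exists_minimal hne
  refine ⟨q, hq.prop.1, hq.prop.2, fun z hpz hzq => ?_⟩
  have hzI : z ∈ I := hI.mem_of_forall_le_or_le fun y hy => by
    rcases hI.1.total hp hy with h | h
    · rcases h.eq_or_lt with rfl | h'
      · exact Or.inr hpz.le
      · left
        refine hzq.le.trans ?_
        rcases hI.1.total hq.prop.1 hy with h'' | h''
        · exact h''
        · exact hq.le_of_le ⟨hy, h'⟩ h''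
    · exact Or.inr (h.trans hpz.le)
  exact hzq.not_ge (hq.le_of_le ⟨hzI, hpz⟩ hzq.le)

/-- `p` can be reached within `F`: some `I ⊆ F` is a maximal chain of the elements `≤ p` and
contains `p`. -/
def ReachableWithin (F : Set P) (p : P) : Prop :=
  ∃ I ⊆ F, p ∈ I ∧ IsChain (· ≤ ·) I ∧ (∀ x ∈ I, x ≤ p) ∧
    ∀ z ≤ p, (∀ x ∈ I, z ≤ x ∨ x ≤ z) → z ∈ I

theorem ReachableWithin.mem {F : Set P} {p : P} (h : ReachableWithin F p) : p ∈ F := by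
  obtain ⟨I, hIF, hp, -⟩ := h
  exact hIF hp

theorem ReachableWithin.of_isMin {F : Set P} {p : P} (hp : p ∈ F) (hmin : IsMin p) :
    ReachableWithin F p :=
  ⟨{p}, by simpa, rfl, Set.subsingleton_singleton.isChain, by simp,
    fun z hz _ => hmin.eq_of_le hz⟩

/-- An element `z ≤ q` comparable with `p` is either below `p`, where saturation applies, or in `[p,
q] = {p, q}`. -/
theorem ReachableWithin.of_covBy {F : Set P} {p q : P} (h : ReachableWithin F p) (hq : q ∈ F)
    (hpq : p ⋖ q) : ReachableWithin F q := by
  obtain ⟨I, hIF, hp, hchain, hle, hsat⟩ := h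
  refine ⟨insert q I, Set.insert_subset hq hIF, Set.mem_insert _ _,
    hchain.insert fun x hx _ => Or.inr ((hle x hx).trans hpq.le), ?_, fun z hz hcomp => ?_⟩
  · rintro x (rfl | hx)
    · exact le_rfl
    · exact (hle x hx).trans hpq.le
  · rcases hcomp p (Set.mem_insert_of_mem _ hp) with h | h
    · exact Set.mem_insert_of_mem _
        (hsat z h fun x hx => hcomp x (Set.mem_insert_of_mem _ hx))
    · rcases hpq.eq_or_eq h hz with rfl | rfl
      · exact Set.mem_insert_of_mem _ hp
      · exact Set.mem_insert _ _

theorem ReachableWithin.exists_isMaxChain {F : Set P} {p : P} (h : ReachableWithin F p)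
    (hmax : IsMax p) : ∃ I ⊆ F, IsMaxChain (· ≤ ·) I := by
  obtain ⟨I, hIF, hp, hchain, hle, hsat⟩ := h
  refine ⟨I, hIF, hchain, fun J hJ hIJ => hIJ.antisymm fun z hz => ?_⟩
  refine hsat z ?_ fun x hx => hJ.total hz (hIJ hx)
  rcases hJ.total hz (hIJ hp) with h | h
  · exact h
  · exact hmax h

end Chains

/-! ### Faces of the join and faces of the restriction -/

section Complexes

variable {P : Type*} [PartialOrder P]

theorem mem_stanleyReisnerComplex_flagIdeal (k : Type*) [Field k] {F : Finset P} :
    F ∈ stanleyReisnerComplex (flagIdeal k P) ↔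
      ∀ I ⊆ F, ¬ IsMaxChain (· ≤ ·) (I : Set P) := by
  change sqfreeMonomial k F ∉ flagIdeal k P ↔ _
  rw [flagIdeal, sqfreeMonomial_mem_span_iff]
  simp only [Set.mem_ofPred_eq, not_exists, not_and]
  exact ⟨fun h I hIF hI => h I hI hIF, fun h I hI hIF => h I hIF hI⟩

theorem mem_stanleyReisnerComplex_edgeIdeal (k : Type*) [Field k] {V : Type*} (G : SimpleGraph V)
    {F : Finset V} :
    F ∈ stanleyReisnerComplex (edgeIdeal k G) ↔ ∀ a ∈ F, ∀ b ∈ F, ¬ G.Adj a b := by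
  classical
  change sqfreeMonomial k F ∉ edgeIdeal k G ↔ _
  rw [edgeIdeal_eq_span, sqfreeMonomial_mem_span_iff]
  constructor
  · intro h a ha b hb hab
    exact h ⟨{a, b}, ⟨a, b, hab, rfl⟩, by simp [Finset.insert_subset_iff, ha, hb]⟩
  · rintro h ⟨_, ⟨a, b, hab, rfl⟩, hF⟩
    exact h a (hF (by simp)) b (hF (by simp)) hab

theorem mem_join_bipartiteComplex (k : Type*) [Field k] (ρ : P → ℕ) (A : Set P) {n : ℕ}
    {G : Finset (Σ i : Fin n, bipartiteVertices ρ A (i + 1))} :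
    G ∈ SComplex.join (fun i : Fin n => bipartiteComplex k ρ A (i + 1)) ↔
      ∀ (i : Fin n) (a b : bipartiteVertices ρ A (i + 1)), ⟨i, a⟩ ∈ G → ⟨i, b⟩ ∈ G → ¬ (a : P) ⋖ b := by
  change (∀ i, _ ∈ stanleyReisnerComplex _) ↔ _
  simp only [mem_stanleyReisnerComplex_edgeIdeal, Finset.mem_preimage, bipartiteGraph,
    SimpleGraph.comap_adj, SimpleGraph.hasse_adj, Function.Embedding.subtype_apply, not_or]
  exact ⟨fun h i a b ha hb => (h i a ha b hb).1, fun h i a ha b hb =>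
    ⟨h i a b ha hb, h i b a hb ha⟩⟩

variable {ρ : P → ℕ} {A : Set P}

theorem rank_of_mem_bipartiteVertices {i : ℕ} {p : P} (hp : p ∈ bipartiteVertices ρ A i) :
    ρ p = i ∨ ρ p = i + 1 :=
  hp.imp (fun h => h.1.2) fun h => h.2

theorem mem_of_mem_bipartiteVertices {i : ℕ} {p : P} (hp : p ∈ bipartiteVertices ρ A i) : p ∈ A :=
  hp.elim (fun h => h.1.1) fun h => h.1

theorem not_isMax_of_mem_bipartiteVertices {i : ℕ} {p : P} (hp : p ∈ bipartiteVertices ρ A i)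
    (hi : ρ p = i) : ¬ IsMax p :=
  hp.elim (fun h => h.2) fun h => absurd (hi.symm.trans h.2) (by omega)

theorem IsRankFunction.two_le [Finite P] (hρ : IsRankFunction ρ) {p : P} (hp : ¬ IsMin p) :
    2 ≤ ρ p := by
  have key : ∀ q : P, 1 ≤ ρ q := fun q => by
    by_cases hq : IsMin q
    · exact (hρ.minimal q hq).ge
    · obtain ⟨q', hq'⟩ := not_isMin_iff.mp hq
      obtain ⟨y, -, hy⟩ := exists_le_covBy_of_lt hq'
      rw [hρ.covBy y q hy]
      omega
  obtain ⟨q, hq⟩ := not_isMin_iff.mp hp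
  obtain ⟨y, -, hy⟩ := exists_le_covBy_of_lt hq
  rw [hρ.covBy y p hy]
  exact Nat.succ_le_succ (key y)

/-- Forgetting the index of the member of the join maps faces of the join of the bipartite
complexes to sets that contain no maximal chain. -/
theorem not_isMaxChain_of_subset_image_join [Finite P] [Nonempty P] (hρ : IsRankFunction ρ)
    {n : ℕ} {G : Finset (Σ i : Fin n, bipartiteVertices ρ A (i + 1))}
    (hG : ∀ (i : Fin n) (a b : bipartiteVertices ρ A (i + 1)), ⟨i, a⟩ ∈ G → ⟨i, b⟩ ∈ G → ¬ (a : P) ⋖ b) {I : Set P}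
    (hI : ∀ p ∈ I, ∃ w ∈ G, (w.2 : P) = p) : ¬ IsMaxChain (· ≤ ·) I := by
  intro hmax
  -- These are the members of `I` with a lift on the lower side of its graph. Minimal elements
  -- qualify, since upper sides have rank at least 2.
  have hS : {p | p ∈ I ∧ ∃ w ∈ G, (w.2 : P) = p ∧ ρ p = (w.1 : ℕ) + 1}.Nonempty := by
    obtain ⟨p, hp, hmin⟩ := hmax.exists_isMin
    obtain ⟨⟨i, v⟩, hw, rfl⟩ := hI p hp
    refine ⟨v, hp, ⟨i, v⟩, hw, rfl, ?_⟩
    have h1 := hρ.minimal _ hmin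
    rcases rank_of_mem_bipartiteVertices v.2 with h | h
    · exact h
    · dsimp only at h1 h
      omega
  obtain ⟨p, ⟨hp, ⟨i, v⟩, hw, rfl, hi⟩, hpmax⟩ := (Set.toFinite _).exists_maximalFor ρ _ hS
  dsimp only at hp hi
  obtain ⟨q, hq, hpq⟩ := hmax.exists_covBy hp (not_isMax_of_mem_bipartiteVertices v.2 hi)
  have hρq := hρ.covBy _ _ hpq
  obtain ⟨⟨j, u⟩, hu, rfl⟩ := hI q hq
  dsimp only at hq hpq hρq
  rcases rank_of_mem_bipartiteVertices u.2 with h | h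
  -- A lower lift of `q` contradicts the choice of `p`; an upper lift lies in the same graph as the
  -- lift of `p` and yields an edge.
  · have := hpmax (j := (u : P)) ⟨hq, ⟨j, u⟩, hu, rfl, h⟩ (by dsimp only; omega)
    dsimp only at this
    omega
  · obtain rfl : i = j := Fin.ext (by omega)
    exact hG i v u hw hu hpq

/-- A nonempty set `F` that contains no maximal chain lifts to a vertex that is isolated among the
vertices of the bipartite graphs over `F`. -/
theorem exists_isolated_vertex [Finite P] (hρ : IsRankFunction ρ) {r : ℕ} (hr : ∀ p, ρ p ≤ r)
    {F : Set P} (hFA : F ⊆ A) (hne : F.Nonempty) (hF : ∀ I ⊆ F, ¬ IsMaxChain (· ≤ ·) I) :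
    ∃ w : Σ i : Fin (r - 1), bipartiteVertices ρ A (i + 1), (w.2 : P) ∈ F ∧
      ∀ b : bipartiteVertices ρ A (w.1 + 1), (b : P) ∈ F → ¬ (w.2 : P) ⋖ b ∧ ¬ (b : P) ⋖ w.2 := by
  by_cases hU : {p | ReachableWithin F p}.Nonempty
  · obtain ⟨p, hp, hpmax⟩ := (Set.toFinite _).exists_maximalFor ρ _ hU
    have hnm : ¬ IsMax p := fun h => by
      obtain ⟨I, hIF, hI⟩ := ReachableWithin.exists_isMaxChain hp h
      exact hF I hIF hI
    have hpF : p ∈ F := ReachableWithin.mem hp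
    obtain ⟨z, hz⟩ := not_isMax_iff.mp hnm
    obtain ⟨q, hq, -⟩ := exists_covBy_le_of_lt hz
    have hρq := hρ.covBy _ _ hq
    have hqr := hr q
    have hq2 := hρ.two_le (not_isMin_of_lt hq.lt)
    -- Index `i` stands for `G_{i+1}`, so this is the lower side of `G_{ρ p}`; the cover `q`
    -- guarantees `ρ p ≤ r - 1`.
    refine ⟨⟨⟨ρ p - 1, by omega⟩, p, Or.inl ⟨⟨hFA hpF, ?_⟩, hnm⟩⟩, hpF, fun b hb => ⟨fun h => ?_,
      fun h => ?_⟩⟩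
    · dsimp only; omega
    · have h1 := hρ.covBy _ _ h
      have := hpmax (j := (b : P)) (ReachableWithin.of_covBy hp hb h) (by dsimp only at h1 ⊢; omega)
      dsimp only at h1 this
      omega
    · have h1 := hρ.covBy _ _ h
      have h2 := rank_of_mem_bipartiteVertices b.2
      dsimp only at h1 h2
      omega
  · obtain ⟨p, hpF, hpmin⟩ := (Set.toFinite F).exists_minimalFor ρ _ hne
    have hnm : ¬ IsMin p := fun h => hU ⟨p, ReachableWithin.of_isMin hpF h⟩
    have hp2 := hρ.two_le hnm
    have hpr := hr p
    -- This is the upper side of `G_{ρ p - 1}`, where a neighbour over `F` would have smaller rank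
    -- than `p`.
    refine ⟨⟨⟨ρ p - 2, by omega⟩, p, Or.inr ⟨hFA hpF, ?_⟩⟩, hpF, fun b hb => ⟨fun h => ?_,
      fun h => ?_⟩⟩
    · dsimp only; omega
    · have h1 := hρ.covBy _ _ h
      have h2 := rank_of_mem_bipartiteVertices b.2
      dsimp only at h1 h2
      omega
    · have h1 := hρ.covBy _ _ h
      have := hpmin (j := (b : P)) hb (by dsimp only at h1 ⊢; omega)
      dsimp only at h1 this
      omega

end Complexes

theorem mainTheorem4 (k : Type*) [Field k] {P : Type*} [Finite P] [PartialOrder P]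
    (ρ : P → ℕ) (hρ : IsRankFunction ρ) (r : ℕ) (hr : IsGreatest (Set.range ρ) r)
    (A : Set P) :
    SComplex.HomotopyEquivalent
      (SComplex.restrict (stanleyReisnerComplex (flagIdeal k P)) A)
      (SComplex.join fun i : Fin (r - 1) => bipartiteComplex k ρ A (i + 1)) := by
  classical
  obtain ⟨p₀, -⟩ := hr.1
  have : Nonempty P := ⟨p₀⟩
  refine SComplex.homotopyEquivalent_of_cone_fibres (fun w => (w.2 : P)) ?_ ?_ ?_
  · exact (mem_join_bipartiteComplex k ρ A).mpr (by simp)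
  · intro G hG
    refine ⟨(mem_stanleyReisnerComplex_flagIdeal k).mpr fun I hI => ?_, ?_⟩
    · exact not_isMaxChain_of_subset_image_join hρ ((mem_join_bipartiteComplex k ρ A).mp hG)
        fun p hp => Finset.mem_image.mp (hI hp)
    · intro p hp
      obtain ⟨w, -, rfl⟩ := Finset.mem_image.mp (Finset.mem_coe.mp hp)
      exact mem_of_mem_bipartiteVertices w.2.2
  · rintro F ⟨hF, hFA⟩ hne
    obtain ⟨⟨i, v⟩, hv, hiso⟩ := exists_isolated_vertex hρ (fun p => hr.2 ⟨p, rfl⟩) hFA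
      (Finset.coe_nonempty.mpr hne) fun I hI hmax => by
        refine (mem_stanleyReisnerComplex_flagIdeal k).mp hF (Set.toFinite I).toFinset ?_ ?_
        · intro p hp
          exact hI (by simpa using hp)
        · simpa using hmax
    refine ⟨⟨i, v⟩, hv, fun G hG hGF => (mem_join_bipartiteComplex k ρ A).mpr ?_⟩
    intro j a b ha hb hab
    rcases Finset.mem_insert.mp ha with ha | haG
    · obtain ⟨rfl, ha⟩ := Sigma.mk.inj_iff.mp ha
      obtain rfl := eq_of_heq ha
      rcases Finset.mem_insert.mp hb with hb | hb
      · obtain rfl := eq_of_heq (Sigma.mk.inj_iff.mp hb).2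
        exact lt_irrefl _ hab.lt
      · exact (hiso b (hGF _ hb)).1 hab
    · rcases Finset.mem_insert.mp hb with hb | hb
      · obtain ⟨rfl, hb⟩ := Sigma.mk.inj_iff.mp hb
        obtain rfl := eq_of_heq hb
        exact (hiso a (hGF ⟨_, a⟩ haG)).2 hab
      · exact (mem_join_bipartiteComplex k ρ A).mp hG j a b haG hb hab
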